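/- Let $G$ be a map on a closed connected orientable surface, i.e. a finite graph embedded in the surface such that all faces are open disks (loops and multiple edges, contractible or not, are allowed). Fix an orientation $D_0$ of the edges of $G$ and a face $f_0$ of $G$. Definitions. An oriented subgraph or a walk $T$ of $G$ is identified with its characteristic flow $\phi(T)\in\mathbb Z^{E(G)}$: with respect to a fixed reference orientation of the edges, $\phi(T)_e$ is the number of times that $T$ uses $e$ forward minus the number of times that it uses $e$ backward. Let $\mathcal F$ be the set of counterclockwise facial walks of $G$, and let $F_0\in\mathcal F$ be that of $f_0$. Two orientations $D,D'$ of $G$ are homologous if $\phi(D)-\phi(D')$ lies in the subgroup of $\mathbb Z^{E(G)}$ generated by the flows $\phi(F)$, $F\in\mathcal F$. Let $O(G,D_0)$ be the set of orientations of $G$ homologous to $D_0$. Let $D\setminus D'$ be the subgraph of $D$ formed by the edges that are oriented differently in $D$ and $D'$, and write $D\le_{f_0}D'$ if $$\phi(D\setminus D')=\sum_{F\in\mathcal F\setminus\{F_0\}}\lambda_F\,\phi(F)\qquad\text{for some } \lambda_F\in\mathbb Z_{\ge 0}.$$ An edge of $G$ is rigid if it has the same orientation in all elements of $O(G,D_0)$.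 Let $\widetilde G$ be the embedded graph obtained from $G$ by deleting the rigid edges (its faces need not be disks), and let $\widetilde f_0$ be the face of $\widetilde G$ that contains $f_0$. Let $\mathcal H$ be the directed graph with vertex set $O(G,D_0)$ and an arc from $D_1$ to $D_2$ if and only if $D_1\setminus D_2$ is the counterclockwise boundary of a face of $\widetilde G$ other than $\widetilde f_0$ (the edges on the boundary of the face, directed with the face on their left). Theorem. $(O(G,D_0),\le_{f_0})$ is a distributive lattice, and $\mathcal H$ is its Hasse diagram: there is an arc from $D_1$ to $D_2$ in $\mathcal H$ if and only if $D_2$ covers $D_1$ in this lattice. -/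

import Mathlib

/-- A finite connected graph cellularly embedded in a closed connected oriented surface (a map),
encoded by its rotation system. The elements of `Dart` (a finite type for a finite map) are the
edges together with a direction of traversal; `rev` reverses the direction, so the edges are the
pairs `{d, rev d}`; `rot` sends a dart to the next dart in counterclockwise order among those with
the same starting vertex, so the vertices are the cycles of `rot`. Loops and multiple edges,
contractible or not, are allowed. The empty type of darts is the map with one vertex and no edge
on the sphere. -/
structure CombinatorialMap (Dart : Type*) where
  rot : Equiv.Perm Dart
  rev : Equiv.Perm Dart
  rev_rev : ∀ d, rev (rev d) = d
  rev_ne : ∀ d, rev d ≠ d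
  /-- the graph (equivalently the surface) is connected -/
  connected : ∀ d d', ∃ g ∈ Subgroup.closure {rot, rev}, g d = d'

namespace CombinatorialMap

variable {Dart : Type*} (M : CombinatorialMap Dart)

/-- The dart following `d` on the facial walk that keeps its face on the left-hand side: arriving
at the end of `d`, take the next dart in clockwise order after `rev d`. -/
def next : Equiv.Perm Dart := M.rot⁻¹ * M.rev

/-- A face, given by the set of the darts that have it on their left. The counterclockwise facial
walk of the face traverses each of these darts exactly once, so this set is a cycle of `next`. The
edgeless map on the sphere has exactly one face, and its facial walk is empty. -/
def IsFace (S : Set Dart) : Prop :=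
  (∃ d, S = {d' | M.next.SameCycle d d'}) ∨ (IsEmpty Dart ∧ S = ∅)

/-- The faces of the map. -/
def Face : Type _ := {S : Set Dart // M.IsFace S}

instance [Finite Dart] : Finite M.Face :=
  inferInstanceAs (Finite {S : Set Dart // M.IsFace S})

noncomputable instance [Finite Dart] : Fintype M.Face := Fintype.ofFinite _

/-- The face on the left of a dart; the face on its right is `M.left (M.rev d)`. -/
def left (d : Dart) : M.Face := ⟨{d' | M.next.SameCycle d d'}, Or.inl ⟨d, rfl⟩⟩

/-- Flows: integer vectors indexed by the edges. The value on an edge directed the other way is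
the opposite number, so no reference orientation of the edges has to be chosen. -/
def Flow : AddSubgroup (Dart → ℤ) where
  carrier := {φ | ∀ d, φ (M.rev d) = -φ d}
  zero_mem' := by simp
  add_mem' := by
    intro a b ha hb d
    simp only [Pi.add_apply, ha d, hb d]
    ring
  neg_mem' := by
    intro a ha d
    simp only [Pi.neg_apply, ha d]

open Classical in
/-- The characteristic flow of a set of darts (an oriented subgraph, or a walk that traverses each
dart at most once): number of forward traversals minus number of backward traversals. -/
noncomputable def charFlow (S : Set Dart) : M.Flow :=
  ⟨fun d => (if d ∈ S then 1 else 0) - (if M.rev d ∈ S then 1 else 0), by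
    intro d
    simp only [M.rev_rev]
    ring⟩

/-- The characteristic flow of the counterclockwise facial walk of a face. -/
noncomputable def faceFlow (f : M.Face) : M.Flow := M.charFlow f.1

/-- The subgroup of flows generated by the facial walks. -/
noncomputable def facialSubgroup : AddSubgroup M.Flow :=
  AddSubgroup.closure (Set.range M.faceFlow)

/-- Two flows are homologous if they differ by an integer combination of facial walks. -/
def Homologous (φ ψ : M.Flow) : Prop := φ - ψ ∈ M.facialSubgroup

/-- An orientation of the graph: exactly one of the two darts of every edge is chosen. -/
@[ext]
structure Orientation where
  darts : Set Dart
  mem_iff : ∀ d, d ∈ darts ↔ M.rev d ∉ darts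

/-- The set `O(G, D₀)` of the orientations that are homologous to `D₀`. -/
def HomologousOrientation (D₀ : M.Orientation) : Type _ :=
  {D : M.Orientation // M.Homologous (M.charFlow D.darts) (M.charFlow D₀.darts)}

variable {M}

open Classical in
/-- An oriented subgraph is counterclockwise with respect to `f₀` if its characteristic flow is a
combination, with natural coefficients, of the counterclockwise facial walks other than that of
`f₀`. -/
def IsCounterclockwise [Finite Dart] (f₀ : M.Face) (T : Set Dart) : Prop :=
  ∃ c : {f : M.Face // f ≠ f₀} → ℕ, M.charFlow T = ∑ f, c f • M.faceFlow f.1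

/-- The relation `D ≤_{f₀} D'`: the subgraph `D \ D'` of `D` formed by the edges that are not
oriented as in `D'` is counterclockwise. -/
def OrientationLE [Finite Dart] (f₀ : M.Face) (D D' : M.Orientation) : Prop :=
  IsCounterclockwise f₀ (D.darts \ D'.darts)

/-- The edge of the dart `d` is rigid: it has the same orientation in all elements of
`O(G, D₀)`. -/
def IsRigid (D₀ : M.Orientation) (d : Dart) : Prop :=
  ∀ D D' : M.HomologousOrientation D₀, d ∈ D.1.darts ↔ d ∈ D'.1.darts

/-- Faces of `G` are equivalent when they lie in the same face (connected component of the
complement) of the embedded graph obtained from `G` by deleting the rigid edges: the equivalence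
relation generated by lying on the two sides of a rigid edge. -/
def mergeSetoid (D₀ : M.Orientation) : Setoid M.Face :=
  Relation.EqvGen.setoid fun f f' =>
    ∃ d, IsRigid D₀ d ∧ M.left d = f ∧ M.left (M.rev d) = f'

/-- The faces of the subgraph of the non-rigid edges. -/
def ReducedFace (D₀ : M.Orientation) : Type _ := Quotient (mergeSetoid D₀)

/-- The face of the subgraph of the non-rigid edges that contains the face `f` of `G`. -/
def toReducedFace (D₀ : M.Orientation) (f : M.Face) : ReducedFace D₀ :=
  Quotient.mk (mergeSetoid D₀) f

/-- The counterclockwise boundary of a face of the subgraph of the non-rigid edges: the non-rigid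
edges, directed so that this face is on their left. -/
def reducedBoundary (D₀ : M.Orientation) (g : ReducedFace D₀) : Set Dart :=
  {d | ¬ IsRigid D₀ d ∧ toReducedFace D₀ (M.left d) = g}

/-- The directed graph of flips on `O(G, D₀)`: there is an arc from `D₁` to `D₂` if and only if
`D₁ \ D₂` is the counterclockwise boundary of a face of the subgraph of the non-rigid edges other
than the face that contains `f₀`. -/
def flipGraph (D₀ : M.Orientation) (f₀ : M.Face) : Digraph (M.HomologousOrientation D₀) where
  Adj D₁ D₂ := ∃ g : ReducedFace D₀, g ≠ toReducedFace D₀ f₀ ∧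
    D₁.1.darts \ D₂.1.darts = reducedBoundary D₀ g

end CombinatorialMap

/-- A directed graph is the Hasse diagram of an ordered set if its arcs are the pairs `(a, b)`
such that `b` covers `a`. -/
def IsHasseDiagram {α : Type*} [PartialOrder α] (H : Digraph α) : Prop :=
  ∀ a b, H.Adj a b ↔ a ⋖ b

/-! Flows homologous to zero are the coboundaries of integer functions on the faces
(`mem_facialSubgroup_iff`). The dual graph is connected, so an orientation homologous to `D₀` is
encoded by a unique `potential` vanishing at `f₀`, and `≤_{f₀}` becomes the pointwise order. Being a
potential only bounds the differences across each edge, so potentials are stable under pointwise max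
and min: they form a distributive sublattice of `M.Face → ℤ`.

Rigid edges are those across which every potential is constant. Potentials thus descend to reduced
faces, and an arc adds the indicator of one of them, which leaves no room for an intermediate
element. Conversely, `exists_flip` finds below any `D₂ > D₁` a reduced face that can be flipped in
`D₁` without overshooting `D₂`; if `D₂` covers `D₁`, this flip yields `D₂`. -/

namespace CombinatorialMap

variable {Dart : Type*} {M : CombinatorialMap Dart}

/-! ### Facial walks and coboundaries -/

theorem mem_face_iff (f : M.Face) (d : Dart) : d ∈ f.1 ↔ M.left d = f := by
  obtain ⟨S, hS⟩ := f
  rcases hS with ⟨e, rfl⟩ | ⟨hE, rfl⟩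
  · constructor
    · intro h
      have h : M.next.SameCycle e d := h
      apply Subtype.ext
      ext x
      exact ⟨fun hx => h.trans hx, fun hx => h.symm.trans hx⟩
    · intro h
      have h' := congrArg Subtype.val h
      have : d ∈ (M.left d).1 := Equiv.Perm.SameCycle.refl _ _
      rw [h] at this
      exact this
  · exact hE.elim d

open Classical in
theorem faceFlow_apply (f : M.Face) (d : Dart) :
    (M.faceFlow f).1 d =
      (if M.left d = f then 1 else 0) - (if M.left (M.rev d) = f then 1 else 0) := by
  simp only [faceFlow, charFlow, mem_face_iff]

theorem sum_smul_faceFlow_apply [Finite Dart] (c : M.Face → ℤ) (d : Dart) :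
    (∑ f, c f • M.faceFlow f : M.Flow).1 d = c (M.left d) - c (M.left (M.rev d)) := by
  classical
  rw [AddSubgroup.val_finsetSum, Finset.sum_apply]
  simp [faceFlow_apply, mul_sub, Finset.sum_sub_distrib]

/-- The elements of the facial subgroup are the coboundaries of the functions on the faces. -/
theorem mem_facialSubgroup_iff [Finite Dart] (φ : M.Flow) :
    φ ∈ M.facialSubgroup ↔
      ∃ c : M.Face → ℤ, ∀ d, φ.1 d = c (M.left d) - c (M.left (M.rev d)) := by
  classical
  constructor
  · intro h
    induction h using AddSubgroup.closure_induction with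
    | mem x hx =>
      obtain ⟨f, rfl⟩ := hx
      exact ⟨fun g => if g = f then 1 else 0, fun d => faceFlow_apply f d⟩
    | zero => exact ⟨0, fun d => by simp⟩
    | add x y _ _ hx hy =>
      obtain ⟨a, ha⟩ := hx
      obtain ⟨b, hb⟩ := hy
      refine ⟨a + b, fun d => ?_⟩
      have := ha d
      have := hb d
      simp only [AddSubgroup.coe_add, Pi.add_apply]
      linarith
    | neg x _ hx =>
      obtain ⟨a, ha⟩ := hx
      refine ⟨-a, fun d => ?_⟩
      have := ha d
      simp only [AddSubgroup.coe_neg, Pi.neg_apply]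
      linarith
  · rintro ⟨c, hc⟩
    have : φ = ∑ f, c f • M.faceFlow f := by
      apply Subtype.ext
      funext d
      rw [sum_smul_faceFlow_apply, hc d]
    rw [this]
    refine sum_mem fun f _ => zsmul_mem (AddSubgroup.subset_closure ?_) _
    exact Set.mem_range_self f

/-- The dual graph is connected: a function on the faces that takes the same value on both sides of
every edge is constant. -/
theorem eq_of_forall_left_eq {α : Type*} {h : M.Face → α}
    (hh : ∀ d, h (M.left d) = h (M.left (M.rev d))) (f g : M.Face) : h f = h g := by
  have key : ∀ σ ∈ Subgroup.closure {M.rot, M.rev}, ∀ d, h (M.left (σ d)) = h (M.left d) := by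
    intro σ hσ
    induction hσ using Subgroup.closure_induction with
    | mem x hx =>
      intro d
      rcases hx with rfl | rfl
      · rw [hh (M.rot d)]
        -- In the corner between `d` and `rot d`, the facial walk arrives by `rev (rot d)` and
        -- leaves by `d`.
        have hc : M.next.SameCycle (M.rev (M.rot d)) d := ⟨1, by simp [next, M.rev_rev]⟩
        have : M.left (M.rev (M.rot d)) = M.left d :=
          ((mem_face_iff (M.left (M.rev (M.rot d))) d).1 hc).symm
        rw [this]
      · exact (hh d).symm
    | one => simp
    | mul x y _ _ hx hy =>
      intro d
      rw [Equiv.Perm.mul_apply, hx, hy]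
    | inv x _ hx =>
      intro d
      rw [← hx (x⁻¹ d)]
      simp
  have hleft : ∀ f : M.Face, IsEmpty Dart ∨ ∃ d, M.left d = f := by
    rintro ⟨S, ⟨d, rfl⟩ | ⟨hE, -⟩⟩
    · exact Or.inr ⟨d, rfl⟩
    · exact Or.inl hE
  rcases hleft f with hE | ⟨d, rfl⟩
  · congr 1
    apply Subtype.ext
    exact Subsingleton.elim _ _
  · rcases hleft g with hE | ⟨e, rfl⟩
    · exact hE.elim d
    · obtain ⟨σ, hσ, rfl⟩ := M.connected d e
      exact (key σ hσ d).symm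

/-! ### Orientations as 0/1 functions on darts -/

namespace Orientation

open Classical in
/-- The indicator function of an orientation. -/
noncomputable def ind (D : M.Orientation) (d : Dart) : ℤ := if d ∈ D.darts then 1 else 0

theorem ind_eq_one_iff (D : M.Orientation) (d : Dart) : D.ind d = 1 ↔ d ∈ D.darts := by
  simp [ind]

theorem ind_eq_zero_iff (D : M.Orientation) (d : Dart) : D.ind d = 0 ↔ d ∉ D.darts := by
  simp [ind]

theorem ind_nonneg (D : M.Orientation) (d : Dart) : 0 ≤ D.ind d := by
  unfold ind; split_ifs <;> simp

theorem ind_le_one (D : M.Orientation) (d : Dart) : D.ind d ≤ 1 := by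
  unfold ind; split_ifs <;> simp

theorem ind_rev (D : M.Orientation) (d : Dart) : D.ind (M.rev d) = 1 - D.ind d := by
  have := D.mem_iff d
  by_cases h : d ∈ D.darts <;> simp_all [ind]

theorem ext_ind {D D' : M.Orientation} (h : ∀ d, D.ind d = D'.ind d) : D = D' := by
  ext d
  rw [← ind_eq_one_iff, h, ind_eq_one_iff]

theorem charFlow_apply (D : M.Orientation) (d : Dart) :
    (M.charFlow D.darts).1 d = 2 * D.ind d - 1 := by
  have : (M.charFlow D.darts).1 d = D.ind d - D.ind (M.rev d) := rfl
  rw [this, ind_rev]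
  ring

theorem charFlow_diff_apply (D D' : M.Orientation) (d : Dart) :
    (M.charFlow (D.darts \ D'.darts)).1 d = D.ind d - D'.ind d := by
  have h := D.mem_iff d
  have h' := D'.mem_iff d
  by_cases hd : d ∈ D.darts <;> by_cases hd' : d ∈ D'.darts <;>
    simp_all [charFlow, ind]

end Orientation

theorem homologous_iff_exists_potential [Finite Dart] (f₀ : M.Face) (D D₀ : M.Orientation) :
    M.Homologous (M.charFlow D.darts) (M.charFlow D₀.darts) ↔
      ∃ p : M.Face → ℤ, p f₀ = 0 ∧
        ∀ d, D₀.ind d - D.ind d = p (M.left d) - p (M.left (M.rev d)) := by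
  rw [Homologous, mem_facialSubgroup_iff]
  simp only [AddSubgroup.coe_sub, Pi.sub_apply, Orientation.charFlow_apply]
  constructor
  · rintro ⟨c, hc⟩
    -- Characteristic flows of orientations differ by even values, so `c` has constant parity and
    -- can be halved once normalized at `f₀`.
    have hpar : ∀ f, c f % 2 = c f₀ % 2 := fun f =>
      eq_of_forall_left_eq (h := fun f => c f % 2) (fun d => by have := hc d; omega) f f₀
    refine ⟨fun f => (c f₀ - c f) / 2, by simp, fun d => ?_⟩
    have h1 := hc d
    have h2 := hpar (M.left d)
    have h3 := hpar (M.left (M.rev d))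
    dsimp only
    omega
  · rintro ⟨p, -, hp⟩
    refine ⟨fun f => -2 * p f, fun d => ?_⟩
    have := hp d
    linarith

theorem orientationLE_iff_exists_nonneg [Finite Dart] (f₀ : M.Face) (D D' : M.Orientation) :
    OrientationLE f₀ D D' ↔ ∃ p : M.Face → ℤ, p f₀ = 0 ∧ 0 ≤ p ∧
      ∀ d, D.ind d - D'.ind d = p (M.left d) - p (M.left (M.rev d)) := by
  classical
  have eval (c : {f : M.Face // f ≠ f₀} → ℕ) (p : M.Face → ℤ) (h0 : p f₀ = 0)
      (hc : ∀ f : {f : M.Face // f ≠ f₀}, (c f : ℤ) = p f.1) (s : Fintype {f : M.Face // f ≠ f₀}) :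
      ∑ f, c f • M.faceFlow f.1 = ∑ f, p f • M.faceFlow f := by
    rw [← Finset.sum_subset (Finset.subset_univ (Finset.univ.filter (· ≠ f₀)))]
    · rw [← Finset.sum_subtype_of_mem (fun f => p f • M.faceFlow f) (p := (· ≠ f₀)) (by simp)]
      refine Finset.sum_congr ?_ fun f _ => ?_
      · ext f
        simpa using f.2
      · rw [← hc f, natCast_zsmul]
    · intro f _ hf
      have : f = f₀ := by simpa using hf
      rw [this, h0, zero_smul]
  constructor
  · rintro ⟨c, hc⟩
    let p : M.Face → ℤ := fun f => if h : f ≠ f₀ then (c ⟨f, h⟩ : ℤ) else 0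
    have h0 : p f₀ = 0 := by simp [p]
    refine ⟨p, h0, fun f => ?_, fun d => ?_⟩
    · dsimp only [p, Pi.zero_apply]
      split_ifs <;> simp
    · rw [eval c p h0 (fun f => by simp [p, f.2])] at hc
      rw [← Orientation.charFlow_diff_apply, hc, sum_smul_faceFlow_apply]
  · rintro ⟨p, h0, hp, h⟩
    refine ⟨fun f => (p f.1).toNat, ?_⟩
    rw [eval _ p h0 (fun f => Int.toNat_of_nonneg (hp f.1))]
    apply Subtype.ext
    funext d
    rw [Orientation.charFlow_diff_apply, sum_smul_faceFlow_apply, h]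

/-! ### Potentials -/

namespace HomologousOrientation

variable [Finite Dart] {D₀ : M.Orientation} (f₀ : M.Face)

/-- The potential of an orientation: the function on the faces that vanishes at `f₀` and whose
coboundary is the difference between `D₀` and the orientation. -/
noncomputable def potential (D : M.HomologousOrientation D₀) : M.Face → ℤ :=
  ((homologous_iff_exists_potential f₀ D.1 D₀).1 D.2).choose

theorem potential_base (D : M.HomologousOrientation D₀) : D.potential f₀ f₀ = 0 :=
  ((homologous_iff_exists_potential f₀ D.1 D₀).1 D.2).choose_spec.1

theorem ind_sub_ind (D : M.HomologousOrientation D₀) (d : Dart) :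
    D₀.ind d - D.1.ind d =
      D.potential f₀ (M.left d) - D.potential f₀ (M.left (M.rev d)) :=
  ((homologous_iff_exists_potential f₀ D.1 D₀).1 D.2).choose_spec.2 d

/-- Two functions with the same coboundary differ by a constant, which is zero because both vanish
at `f₀`. -/
theorem eq_potential_sub {D D' : M.HomologousOrientation D₀} {p : M.Face → ℤ} (h0 : p f₀ = 0)
    (hp : ∀ d, D.1.ind d - D'.1.ind d = p (M.left d) - p (M.left (M.rev d))) :
    p = D'.potential f₀ - D.potential f₀ := by
  funext f
  have := eq_of_forall_left_eq (h := fun f => p f - (D'.potential f₀ f - D.potential f₀ f))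
    (fun d => by
      have h1 := hp d
      have h2 := D.ind_sub_ind f₀ d
      have h3 := D'.ind_sub_ind f₀ d
      linarith) f f₀
  simp only [h0, potential_base] at this
  simp only [Pi.sub_apply]
  linarith

theorem potential_injective :
    Function.Injective (potential f₀ : M.HomologousOrientation D₀ → M.Face → ℤ) := by
  intro D D' h
  apply Subtype.ext
  refine Orientation.ext_ind fun d => ?_
  have h1 := D.ind_sub_ind f₀ d
  have h2 := D'.ind_sub_ind f₀ d
  rw [h] at h1
  linarith

theorem exists_potential_eq {p : M.Face → ℤ} (h0 : p f₀ = 0)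
    (hp : ∀ d, 0 ≤ D₀.ind d - (p (M.left d) - p (M.left (M.rev d))) ∧
      D₀.ind d - (p (M.left d) - p (M.left (M.rev d))) ≤ 1) :
    ∃ D : M.HomologousOrientation D₀, D.potential f₀ = p := by
  let D : M.Orientation :=
    { darts := {d | D₀.ind d - (p (M.left d) - p (M.left (M.rev d))) = 1}
      mem_iff := fun d => by
        have h1 := hp d
        have h2 := D₀.ind_rev d
        simp only [Set.mem_ofPred_eq, M.rev_rev]
        omega }
  have hD : ∀ d, D₀.ind d - D.ind d = p (M.left d) - p (M.left (M.rev d)) := by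
    intro d
    have h1 := hp d
    by_cases h : d ∈ D.darts
    · rw [(D.ind_eq_one_iff d).2 h]
      have h : _ = (1 : ℤ) := h
      omega
    · rw [(D.ind_eq_zero_iff d).2 h]
      have h : ¬ _ = (1 : ℤ) := h
      omega
  let E₀ : M.HomologousOrientation D₀ := ⟨D₀, by simp [Homologous, zero_mem]⟩
  let E : M.HomologousOrientation D₀ :=
    ⟨D, (homologous_iff_exists_potential f₀ D D₀).2 ⟨p, h0, hD⟩⟩
  refine ⟨E, ?_⟩
  -- Both `p` and the potential of `E` equal the potential of `E` minus that of `E₀`.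
  rw [eq_potential_sub f₀ (D := E₀) (D' := E) h0 hD]
  exact eq_potential_sub f₀ (D := E₀) (D' := E) (potential_base f₀ E) (E.ind_sub_ind f₀)

/-! ### The distributive lattice -/

/-- Across an edge, the difference of the maximum lies between the differences of the two
potentials, so it obeys the same bounds. -/
theorem exists_potential_sup (D D' : M.HomologousOrientation D₀) :
    ∃ E : M.HomologousOrientation D₀, E.potential f₀ = D.potential f₀ ⊔ D'.potential f₀ := by
  refine exists_potential_eq f₀ (by simp [potential_base]) fun d => ?_
  have h1 := D.ind_sub_ind f₀ d
  have h2 := D'.ind_sub_ind f₀ d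
  have := D.1.ind_nonneg d
  have := D.1.ind_le_one d
  have := D'.1.ind_nonneg d
  have := D'.1.ind_le_one d
  simp only [Pi.sup_apply]
  omega

theorem exists_potential_inf (D D' : M.HomologousOrientation D₀) :
    ∃ E : M.HomologousOrientation D₀, E.potential f₀ = D.potential f₀ ⊓ D'.potential f₀ := by
  refine exists_potential_eq f₀ (by simp [potential_base]) fun d => ?_
  have h1 := D.ind_sub_ind f₀ d
  have h2 := D'.ind_sub_ind f₀ d
  have := D.1.ind_nonneg d
  have := D.1.ind_le_one d
  have := D'.1.ind_nonneg d
  have := D'.1.ind_le_one d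
  simp only [Pi.inf_apply]
  omega

/-- The lattice of the homologous orientations, a sublattice of the functions on the faces. -/
noncomputable abbrev distribLattice : DistribLattice (M.HomologousOrientation D₀) :=
  letI : LE (M.HomologousOrientation D₀) := ⟨fun D D' => D.potential f₀ ≤ D'.potential f₀⟩
  letI : LT (M.HomologousOrientation D₀) := ⟨fun D D' => D.potential f₀ < D'.potential f₀⟩
  letI : Max (M.HomologousOrientation D₀) := ⟨fun D D' => (exists_potential_sup f₀ D D').choose⟩
  letI : Min (M.HomologousOrientation D₀) := ⟨fun D D' => (exists_potential_inf f₀ D D').choose⟩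
  (potential_injective f₀).distribLattice _ Iff.rfl Iff.rfl
    (fun D D' => (exists_potential_sup f₀ D D').choose_spec)
    (fun D D' => (exists_potential_inf f₀ D D').choose_spec)

theorem orientationLE_iff (D D' : M.HomologousOrientation D₀) :
    OrientationLE f₀ D.1 D'.1 ↔ D.potential f₀ ≤ D'.potential f₀ := by
  rw [orientationLE_iff_exists_nonneg]
  constructor
  · rintro ⟨p, h0, hp, h⟩
    rw [eq_potential_sub f₀ h0 h] at hp
    exact sub_nonneg.1 hp
  · intro h
    refine ⟨D'.potential f₀ - D.potential f₀, by simp [potential_base], sub_nonneg.2 h,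
      fun d => ?_⟩
    have h1 := D.ind_sub_ind f₀ d
    have h2 := D'.ind_sub_ind f₀ d
    simp only [Pi.sub_apply]
    linarith

/-! ### Rigid edges and reduced faces -/

theorem isRigid_iff (d : Dart) :
    IsRigid D₀ d ↔ ∀ D : M.HomologousOrientation D₀,
      D.potential f₀ (M.left d) = D.potential f₀ (M.left (M.rev d)) := by
  constructor
  · intro h D
    have h1 := D.ind_sub_ind f₀ d
    have h2 : D₀.ind d = D.1.ind d := by
      have : d ∈ D₀.darts ↔ d ∈ D.1.darts := h ⟨D₀, by simp [Homologous, zero_mem]⟩ D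
      by_cases hd : d ∈ D₀.darts <;> simp_all [Orientation.ind]
    omega
  · intro h D D'
    have h1 := D.ind_sub_ind f₀ d
    have h2 := D'.ind_sub_ind f₀ d
    have h3 := h D
    have h4 := h D'
    rw [← Orientation.ind_eq_one_iff, ← Orientation.ind_eq_one_iff]
    omega

theorem potential_eq_of_toReducedFace_eq (D : M.HomologousOrientation D₀) {f g : M.Face}
    (h : toReducedFace D₀ f = toReducedFace D₀ g) : D.potential f₀ f = D.potential f₀ g := by
  have hfg : Relation.EqvGen _ f g := Quotient.exact h
  clear h
  induction hfg with
  | rel x y h =>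
    obtain ⟨d, hd, rfl, rfl⟩ := h
    exact (isRigid_iff f₀ d).1 hd D
  | refl => rfl
  | symm _ _ _ ih => exact ih.symm
  | trans _ _ _ _ _ ih ih' => exact ih.trans ih'

/-- An edge is rigid if and only if both its sides lie in the same reduced face. -/
theorem isRigid_iff_toReducedFace_eq (d : Dart) :
    IsRigid D₀ d ↔ toReducedFace D₀ (M.left d) = toReducedFace D₀ (M.left (M.rev d)) := by
  constructor
  · intro h
    exact Quotient.sound (Relation.EqvGen.rel _ _ ⟨d, h, rfl, rfl⟩)
  · intro h
    -- Rigidity does not involve a base face, so any face serves as one.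
    exact (isRigid_iff (M.left d) d).2 fun D => potential_eq_of_toReducedFace_eq _ D h

open Classical in
theorem diff_eq_reducedBoundary_iff (D₁ D₂ : M.HomologousOrientation D₀) {g : ReducedFace D₀}
    (hg : g ≠ toReducedFace D₀ f₀) :
    D₁.1.darts \ D₂.1.darts = reducedBoundary D₀ g ↔
      ∀ f, D₂.potential f₀ f = D₁.potential f₀ f + if toReducedFace D₀ f = g then 1 else 0 := by
  constructor
  · intro h f
    have := congrFun (eq_potential_sub f₀ (D := D₁) (D' := D₂)
      (p := fun f => if toReducedFace D₀ f = g then 1 else 0) (by simp [hg.symm]) fun d => by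
        rw [← Orientation.charFlow_diff_apply, h]
        simp only [charFlow, reducedBoundary, Set.mem_ofPred_eq, isRigid_iff_toReducedFace_eq,
          M.rev_rev]
        grind) f
    simp only [Pi.sub_apply] at this
    linarith
  · intro h
    ext d
    have h1 := D₁.ind_sub_ind f₀ d
    have h2 := D₂.ind_sub_ind f₀ d
    have := D₁.1.ind_nonneg d
    have := D₁.1.ind_le_one d
    have := D₂.1.ind_nonneg d
    have := D₂.1.ind_le_one d
    rw [h, h] at h2
    simp only [Set.mem_sdiff, reducedBoundary, Set.mem_ofPred_eq, isRigid_iff_toReducedFace_eq,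
      ← Orientation.ind_eq_one_iff]
    grind

/-! ### Existence of flips -/

instance : Finite (M.HomologousOrientation D₀) :=
  Finite.of_injective (fun D => D.1.darts) fun _ _ h => Subtype.ext (Orientation.ext h)

/-- Between two comparable orientations, some reduced face can be flipped. -/
theorem exists_flip {D₁ D₂ : M.HomologousOrientation D₀}
    (h : D₁.potential f₀ < D₂.potential f₀) :
    ∃ f, D₁.potential f₀ f < D₂.potential f₀ f ∧
      ∀ d, ¬ IsRigid D₀ d → toReducedFace D₀ (M.left d) = toReducedFace D₀ f → d ∈ D₁.1.darts := by
  classical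
  have := Fintype.ofFinite (M.HomologousOrientation D₀)
  -- `Q` breaks ties: it strictly increases from left to right across any non-rigid dart absent from
  -- `D₁`, because some `D` contains that dart.
  let Q : M.Face → ℤ := fun f => ∑ D : M.HomologousOrientation D₀,
    (D.potential f₀ f - D₁.potential f₀ f)
  have hQ : ∀ d, ¬ IsRigid D₀ d → d ∉ D₁.1.darts → Q (M.left d) < Q (M.left (M.rev d)) := by
    intro d hd hd1
    have hz := (D₁.1.ind_eq_zero_iff d).2 hd1
    have hle (D : M.HomologousOrientation D₀) := D.ind_sub_ind f₀ d
    have h1 := hle D₁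
    refine Finset.sum_lt_sum (fun D _ => ?_) ?_
    · have := hle D
      have := D.1.ind_nonneg d
      omega
    · have : ∃ D : M.HomologousOrientation D₀, d ∈ D.1.darts := by
        by_contra! hn
        exact hd fun D D' => by simp [hn]
      obtain ⟨D, hD⟩ := this
      refine ⟨D, Finset.mem_univ _, ?_⟩
      have := hle D
      have := (D.1.ind_eq_one_iff d).2 hD
      omega
  obtain ⟨hle, f₁, hf₁⟩ := Pi.lt_def.1 h
  have : Nonempty M.Face := ⟨f₀⟩
  -- Across a dart absent from `D₁`, the first coordinate cannot decrease from left to right. A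
  -- non-rigid one bordering the reduced face of a lexicographic maximum would therefore contradict
  -- maximality through `Q`.
  obtain ⟨f, hf⟩ := Finite.exists_max fun f =>
    toLex (D₂.potential f₀ f - D₁.potential f₀ f, Q f)
  have hmax : ∀ g, D₂.potential f₀ g - D₁.potential f₀ g ≤
      D₂.potential f₀ f - D₁.potential f₀ f := by
    intro g
    have := (Prod.Lex.le_iff).1 (hf g)
    simp only [ofLex_toLex] at this
    omega
  refine ⟨f, by have := hmax f₁; linarith, fun d hd hdf => ?_⟩
  by_contra hd1
  have hlt := hQ d hd hd1
  have e1 := D₁.potential_eq_of_toReducedFace_eq f₀ hdf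
  have e2 := D₂.potential_eq_of_toReducedFace_eq f₀ hdf
  have e3 : Q (M.left d) = Q f := Finset.sum_congr rfl fun D _ => by
    rw [D.potential_eq_of_toReducedFace_eq f₀ hdf, e1]
  have hz := (D₁.1.ind_eq_zero_iff d).2 hd1
  have h1 := D₁.ind_sub_ind f₀ d
  have h2 := D₂.ind_sub_ind f₀ d
  have h3 := D₂.1.ind_nonneg d
  have := (Prod.Lex.le_iff).1 (hf (M.left (M.rev d)))
  simp only [ofLex_toLex] at this
  omega

-- Raising the potential on `g` reverses exactly the edges around `g`, and the hypothesis says that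
-- all of them have `g` on their left in `D₁`.
open Classical in
theorem exists_potential_add {D₁ : M.HomologousOrientation D₀} {g : ReducedFace D₀}
    (hg : g ≠ toReducedFace D₀ f₀)
    (h : ∀ d, ¬ IsRigid D₀ d → toReducedFace D₀ (M.left d) = g → d ∈ D₁.1.darts) :
    ∃ D : M.HomologousOrientation D₀,
      ∀ f, D.potential f₀ f = D₁.potential f₀ f + if toReducedFace D₀ f = g then 1 else 0 := by
  have := exists_potential_eq (D₀ := D₀) f₀
    (p := fun f => D₁.potential f₀ f + if toReducedFace D₀ f = g then 1 else 0)
    (by simp [hg.symm, potential_base]) fun d => by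
      have h1 := D₁.ind_sub_ind f₀ d
      have := D₁.1.ind_nonneg d
      have := D₁.1.ind_le_one d
      have hl := h d
      have hr := h (M.rev d)
      simp only [isRigid_iff_toReducedFace_eq, M.rev_rev, ← Orientation.ind_eq_one_iff,
        Orientation.ind_rev] at hl hr
      grind
  obtain ⟨D, hD⟩ := this
  exact ⟨D, fun f => congrFun hD f⟩

end HomologousOrientation

end CombinatorialMap

/-! ### Arcs are covers -/

open CombinatorialMap HomologousOrientation in
theorem theorem4p7 {Dart : Type*} [Finite Dart] (M : CombinatorialMap Dart)
    (D₀ : M.Orientation) (f₀ : M.Face) :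
    ∃ _ : DistribLattice (M.HomologousOrientation D₀),
      (∀ D D' : M.HomologousOrientation D₀,
        D ≤ D' ↔ CombinatorialMap.OrientationLE f₀ D.1 D'.1) ∧
      IsHasseDiagram (CombinatorialMap.flipGraph D₀ f₀) := by
  classical
  refine ⟨distribLattice f₀, fun D D' => (orientationLE_iff f₀ D D').symm, fun D₁ D₂ => ?_⟩
  let _ := distribLattice (D₀ := D₀) f₀
  constructor
  · rintro ⟨g, hg, h⟩
    rw [diff_eq_reducedBoundary_iff f₀ D₁ D₂ hg] at h
    obtain ⟨f, rfl⟩ := Quotient.exists_rep g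
    have hf : D₂.potential f₀ f = D₁.potential f₀ f + 1 := by
      rw [h f, if_pos]; rfl
    refine ⟨Pi.lt_def.2 ⟨fun e => ?_, f, by omega⟩, fun D hD₁ hD₂ => ?_⟩
    · rw [h e]
      split_ifs <;> simp
    · have hD₁' : D₁.potential f₀ < D.potential f₀ := hD₁
      have hD₂' : D.potential f₀ < D₂.potential f₀ := hD₂
      obtain ⟨l1, a, ha⟩ := Pi.lt_def.1 hD₁'
      obtain ⟨l2, b, hb⟩ := Pi.lt_def.1 hD₂'
      have ka : D.potential f₀ a ≤ D₂.potential f₀ a := l2 a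
      have kb : D₁.potential f₀ b ≤ D.potential f₀ b := l1 b
      rw [h] at ka hb
      split_ifs at ka hb with h1 h2 h2
      -- `a` and `b` lie in the same reduced face, where the total rise of 1 would have to split
      -- into two positive integers.
      · have e := h1.trans h2.symm
        have := D.potential_eq_of_toReducedFace_eq f₀ e
        have := D₁.potential_eq_of_toReducedFace_eq f₀ e
        omega
      all_goals omega
  · intro h
    obtain ⟨f, hf, hflip⟩ := exists_flip f₀ (show D₁.potential f₀ < D₂.potential f₀ from h.lt)
    have hg : toReducedFace D₀ f ≠ toReducedFace D₀ f₀ := by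
      intro e
      rw [D₁.potential_eq_of_toReducedFace_eq f₀ e, D₂.potential_eq_of_toReducedFace_eq f₀ e,
        potential_base, potential_base] at hf
      exact lt_irrefl _ hf
    refine ⟨toReducedFace D₀ f, hg, ?_⟩
    rw [diff_eq_reducedBoundary_iff f₀ D₁ D₂ hg]
    obtain ⟨D, hD⟩ := exists_potential_add f₀ hg hflip
    have hlt : D₁ < D := by
      refine Pi.lt_def.2 ⟨fun e => ?_, f, by simp [hD]⟩
      rw [hD e]
      split_ifs <;> simp
    have hle : D ≤ D₂ := by
      intro e
      have hle : D₁.potential f₀ e ≤ D₂.potential f₀ e := h.le e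
      rw [hD e]
      split_ifs with he
      · rw [D₁.potential_eq_of_toReducedFace_eq f₀ he, D₂.potential_eq_of_toReducedFace_eq f₀ he]
        exact hf
      · simpa using hle
    rwa [← hle.eq_of_not_lt (h.2 hlt)]
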